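/- Let $X$ be a finite-dimensional Euclidean space, $\mu$ a Borel probability measure on $X$, and $f\colon X\to X$ a Borel measurable map that preserves $\mu$ and is continuous at $\mu$-a.e. point. For a finite measurable partition $\xi$ of $X$ let $\xi(x)$ be the element of $\xi$ containing $x$, let $\xi^n=\xi\vee f^{-1}\xi\vee\dots\vee f^{-n+1}\xi$, and let $h_\mu(f,\xi)=\lim_{n}\frac1n H_\mu(\xi^n)$, where $H_\mu(\eta)=-\sum_{C\in\eta}\mu(C)\log\mu(C)$; let $h_\mu(f)=\sup_\xi h_\mu(f,\xi)$ over all such partitions. Suppose that $(X,f,\mu)$ is reasonably sensitive: for $\mu$-a.e. $x$ there are $\gamma,\lambda>0$ such that, for all sufficiently large $n$, the iterate $f^n$ is $e^{\lambda n}$-Lipschitz on the ball $B(x,e^{-\gamma n})$. Suppose also that $h_\mu(f)>0$. Then there is a finite measurable partition $\xi$ of $X$ with $h_\mu(f,\xi)>0$ that has large interior: for $\mu$-a.e. $x$ there is $\chi=\chi(x)<\infty$ such that $B(x,e^{-\chi n})\subset\xi^n(x)$ for all sufficiently large $n$. -/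

import Mathlib

open Set Filter Topology MeasureTheory

/-- A measurable partition of `X`, with cells indexed by `ι` (empty cells are allowed). -/
structure MeasPartition (ι X : Type*) [MeasurableSpace X] where
  cell : ι → Set X
  measurableSet_cell : ∀ i, MeasurableSet (cell i)
  disjoint_cell : ∀ i j, i ≠ j → Disjoint (cell i) (cell j)
  iUnion_cell : ⋃ i, cell i = univ

namespace MeasPartition

variable {ι X : Type*} [MeasurableSpace X]

/-- `ξ(x)`: the element of the partition `ξ` that contains `x`. -/
def atom (ξ : MeasPartition ι X) (x : X) : Set X :=
  {y | ∃ i, x ∈ ξ.cell i ∧ y ∈ ξ.cell i}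

theorem atom_eq_cell (ξ : MeasPartition ι X) {x : X} {i : ι} (hx : x ∈ ξ.cell i) :
    ξ.atom x = ξ.cell i := by
  ext y
  constructor
  · rintro ⟨j, hj, hy⟩
    by_cases h : j = i
    · exact h ▸ hy
    · exact absurd hx (Set.disjoint_left.mp (ξ.disjoint_cell j i h) hj)
  · intro hy
    exact ⟨i, hx, hy⟩

/-- The dynamical partition `ξ ∨ f⁻¹ξ ∨ ⋯ ∨ f^{-(n-1)}ξ`; its cells are the sets
`⋂_{k<n} f^{-k}(ξ_{a k})`, indexed by the words `a` of length `n`. -/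
def dynamical (ξ : MeasPartition ι X) (f : X → X) (hf : Measurable f) (n : ℕ) :
    MeasPartition (Fin n → ι) X where
  cell a := ⋂ k : Fin n, f^[k] ⁻¹' ξ.cell (a k)
  measurableSet_cell a :=
    MeasurableSet.iInter fun k => (hf.iterate k) (ξ.measurableSet_cell (a k))
  disjoint_cell a b hab := by
    obtain ⟨k, hk⟩ := Function.ne_iff.mp hab
    rw [Set.disjoint_left]
    intro x hxa hxb
    exact Set.disjoint_left.mp (ξ.disjoint_cell _ _ hk)
      (Set.mem_iInter.mp hxa k) (Set.mem_iInter.mp hxb k)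
  iUnion_cell := by
    refine Set.eq_univ_of_forall fun x => ?_
    have h : ∀ k : Fin n, ∃ i, f^[k] x ∈ ξ.cell i := fun k =>
      Set.mem_iUnion.mp (ξ.iUnion_cell ▸ Set.mem_univ (f^[k] x))
    choose a ha using h
    exact Set.mem_iUnion.mpr ⟨a, Set.mem_iInter.mpr ha⟩

/-- The Shannon entropy `H_μ(ξ) = -∑ μ(C) log μ(C)` of a finite partition. -/
noncomputable def shannonEntropy [Fintype ι] (ξ : MeasPartition ι X) (μ : Measure X) : ℝ :=
  ∑ i, Real.negMulLog (μ.real (ξ.cell i))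

/-- The entropy `h_μ(f, ξ) = lim_n (1/n) H_μ(ξ^n)` of a finite partition. The limit exists by
subadditivity when `μ` is an invariant probability measure, so it is equal to the limsup. -/
noncomputable def entropy [Fintype ι] (ξ : MeasPartition ι X) (f : X → X) (hf : Measurable f)
    (μ : Measure X) : EReal :=
  limsup (fun n : ℕ => (((ξ.dynamical f hf n).shannonEntropy μ / n : ℝ) : EReal)) atTop

/-- `ξ` has large interior: for `μ`-a.e. `x` there is `χ` such that `B(x, e^{-χ n}) ⊆ ξ^n(x)`
for all large `n`. -/
def HasLargeInterior {X : Type*} [MetricSpace X] [MeasurableSpace X]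
    (ξ : MeasPartition ι X) (f : X → X) (hf : Measurable f) (μ : Measure X) : Prop :=
  ∀ᵐ x ∂μ, ∃ χ : ℝ, ∀ᶠ n : ℕ in atTop,
    Metric.ball x (Real.exp (-χ * n)) ⊆ (ξ.dynamical f hf n).atom x

end MeasPartition

/-- The metric (Kolmogorov-Sinai) entropy `h_μ(f)`: the supremum of `h_μ(f, ξ)` over all finite
measurable partitions `ξ`. -/
noncomputable def metricEntropy {X : Type*} [MeasurableSpace X] (f : X → X) (hf : Measurable f)
    (μ : Measure X) : EReal :=
  ⨆ (k : ℕ) (ξ : MeasPartition (Fin k) X), ξ.entropy f hf μ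

/-- The system is reasonably sensitive: for `μ`-a.e. `x` there are `γ, lam > 0` such that, for all
large `n`, the iterate `f^n` is `e^{lam n}`-Lipschitz on the ball `B(x, e^{-γ n})`. -/
def ReasonablySensitive {X : Type*} [MetricSpace X] [MeasurableSpace X]
    (f : X → X) (μ : Measure X) : Prop :=
  ∀ᵐ x ∂μ, ∃ γ > (0 : ℝ), ∃ lam > (0 : ℝ), ∀ᶠ n : ℕ in atTop,
    LipschitzOnWith (Real.toNNReal (Real.exp (lam * n))) (f^[n])
      (Metric.ball x (Real.exp (-γ * n)))

/-! A partition `g` of positive entropy is replaced by a nearby partition `h` whose cells are cut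
out by levels `φ i = r` of Lipschitz functions. Positivity survives because h(f, g) ≤ h(f, h) + H(g
| h) (`labelEntropy_itinerary_le`). The conditional entropy H(g | h) depends continuously on the
joint weights and vanishes when `h` determines `g`, so it is small for a good approximation. Large
interior comes from the choice of `r`. By Fubini, for almost every `r` the layers of width `c * exp
(-n)` around the levels have summable measure, so by Borel–Cantelli a typical orbit at time n is
eventually at least that far from every level. Sensitivity keeps a point that starts exponentially
close within `exp (-k)` of the orbit at all late times k, too close to cross a level. The finitely
many early times are covered by continuity (`ae_exists_thresholdLabel_iterate_eq`). -/

/-! ### Gibbs' inequality and conditional entropy of finite matrices -/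

/-- The Shannon entropy of a label function `g` with finitely many values. -/
noncomputable def labelEntropy {X ι : Type*} [MeasurableSpace X] [Fintype ι] (μ : Measure X)
    (g : X → ι) : ℝ :=
  ∑ i, Real.negMulLog (μ.real (g ⁻¹' {i}))

/-- The conditional entropy of the row given the column, for a matrix of joint weights. -/
noncomputable def matrixCondEntropy {ι κ : Type*} [Fintype ι] [Fintype κ] (p : ι × κ → ℝ) : ℝ :=
  ∑ c, Real.negMulLog (p c) - ∑ j, Real.negMulLog (∑ i, p (i, j))

theorem negMulLog_le_of_gibbs {p q : ℝ} (hp : 0 ≤ p) (hq : 0 ≤ q) (h : 0 < p → 0 < q) :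
    Real.negMulLog p ≤ p * (-Real.log q) + (q - p) := by
  rcases hp.eq_or_lt with rfl | hp
  · simpa using hq
  · have hq := h hp
    have h1 := Real.log_le_sub_one_of_pos (div_pos hq hp)
    rw [Real.log_div hq.ne' hp.ne'] at h1
    have h2 := mul_le_mul_of_nonneg_left h1 hp.le
    have h3 : p * (q / p - 1) = q - p := by field_simp
    rw [h3] at h2
    unfold Real.negMulLog
    linarith

/-- Gibbs' inequality. -/
theorem sum_negMulLog_le {ι : Type*} [Fintype ι] {p q : ι → ℝ} (hp : ∀ i, 0 ≤ p i)
    (hq : ∀ i, 0 ≤ q i) (h : ∀ i, 0 < p i → 0 < q i) (hsum : ∑ i, q i ≤ ∑ i, p i) :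
    ∑ i, Real.negMulLog (p i) ≤ ∑ i, p i * (-Real.log (q i)) := by
  have := Finset.sum_le_sum fun i (_ : i ∈ Finset.univ) =>
    negMulLog_le_of_gibbs (hp i) (hq i) (h i)
  rw [Finset.sum_add_distrib, Finset.sum_sub_distrib] at this
  linarith

theorem matrixCondEntropy_eq {ι κ : Type*} [Fintype ι] [Fintype κ] {p : ι × κ → ℝ}
    (hp : ∀ c, 0 ≤ p c) :
    matrixCondEntropy p = ∑ c, p c * (-Real.log (p c / ∑ i, p (i, c.2))) := by
  have h : ∀ c, p c * (-Real.log (p c / ∑ i, p (i, c.2))) =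
      Real.negMulLog (p c) + p c * Real.log (∑ i, p (i, c.2)) := by
    intro c
    rcases (hp c).eq_or_lt with h0 | h0
    · simp [← h0]
    · have h1 : p c ≤ ∑ i, p (i, c.2) :=
        Finset.single_le_sum (f := fun i => p (i, c.2)) (fun i _ => hp _) (Finset.mem_univ c.1)
      rw [Real.log_div h0.ne' (h0.trans_le h1).ne', Real.negMulLog]
      ring
  rw [Finset.sum_congr rfl fun c _ => h c, Finset.sum_add_distrib, matrixCondEntropy,
    Fintype.sum_prod_type_right (f := fun c => p c * Real.log (∑ i, p (i, c.2)))]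
  simp only [← Finset.sum_mul, Real.negMulLog]
  rw [sub_eq_add_neg, ← Finset.sum_neg_distrib]
  simp

theorem continuous_matrixCondEntropy {ι κ : Type*} [Fintype ι] [Fintype κ] :
    Continuous (matrixCondEntropy (ι := ι) (κ := κ)) := by
  unfold matrixCondEntropy
  have := Real.continuous_negMulLog
  fun_prop

/-- By injectivity of `e` each column has at most one nonzero entry, so every conditional weight
that counts equals 1. -/
theorem matrixCondEntropy_graph {ι κ : Type*} [Fintype ι] [Fintype κ] [DecidableEq κ]
    {w : ι → ℝ} (hw : ∀ i, 0 ≤ w i) {e : ι → κ} (he : Function.Injective e) :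
    matrixCondEntropy (fun c : ι × κ => if c.2 = e c.1 then w c.1 else 0) = 0 := by
  classical
  rw [matrixCondEntropy_eq fun c => by split_ifs; exacts [hw _, le_rfl]]
  refine Finset.sum_eq_zero fun c _ => ?_
  by_cases h : c.2 = e c.1
  · simp only [h, he.eq_iff, if_true, Finset.sum_ite_eq, Finset.mem_univ]
    by_cases h0 : w c.1 = 0
    · simp [h0]
    · simp [div_self h0]
  · simp [h]

/-! ### Entropy of labels and itineraries -/

section Labels

variable {X : Type*} [MeasurableSpace X] {μ : Measure X} [IsFiniteMeasure μ]

theorem measureReal_preimage_comp {ι κ : Type*} [Fintype ι] [DecidableEq κ] {g : X → ι}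
    (hg : ∀ i, MeasurableSet (g ⁻¹' {i})) (φ : ι → κ) (j : κ) :
    μ.real ((fun x => φ (g x)) ⁻¹' {j}) =
      ∑ i with φ i = j, μ.real (g ⁻¹' {i}) := by
  rw [sum_measureReal_preimage_singleton _ fun i _ => hg i]
  congr 1
  ext x
  simp

theorem sum_measureReal_preimage_mul {ι κ : Type*} [Fintype ι] [Fintype κ] {g : X → ι}
    (hg : ∀ i, MeasurableSet (g ⁻¹' {i})) (φ : ι → κ) (F : κ → ℝ) :
    ∑ i, μ.real (g ⁻¹' {i}) * F (φ i) =
      ∑ j, μ.real ((fun x => φ (g x)) ⁻¹' {j}) * F j := by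
  classical
  rw [← Finset.sum_fiberwise Finset.univ φ]
  refine Finset.sum_congr rfl fun j _ => ?_
  rw [measureReal_preimage_comp hg, Finset.sum_mul]
  refine Finset.sum_congr rfl fun i hi => ?_
  rw [(Finset.mem_filter.mp hi).2]

theorem measureReal_preimage_le_comp {ι κ : Type*} (g : X → ι) (φ : ι → κ) (i : ι) :
    μ.real (g ⁻¹' {i}) ≤ μ.real ((fun x => φ (g x)) ⁻¹' {φ i}) :=
  measureReal_mono fun x hx => by
    have : g x = i := hx
    simp [this]

/-- A finer label function has larger entropy. -/
theorem labelEntropy_comp_le {ι κ : Type*} [Fintype ι] [Fintype κ] {g : X → ι}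
    (hg : ∀ i, MeasurableSet (g ⁻¹' {i})) (φ : ι → κ) :
    labelEntropy μ (fun x => φ (g x)) ≤
      labelEntropy μ g := by
  have h := sum_measureReal_preimage_mul (μ := μ) hg φ
    fun j => -Real.log (μ.real ((fun x => φ (g x)) ⁻¹' {j}))
  have h' : labelEntropy μ (fun x => φ (g x)) =
      ∑ j, μ.real ((fun x => φ (g x)) ⁻¹' {j}) *
        -Real.log (μ.real ((fun x => φ (g x)) ⁻¹' {j})) := by
    simp [labelEntropy, Real.negMulLog]
  rw [h', ← h, labelEntropy]
  gcongr with i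
  rcases (measureReal_nonneg (μ := μ) (s := g ⁻¹' {i})).eq_or_lt with h0 | h0
  · simp [← h0]
  · rw [Real.negMulLog, neg_mul, ← mul_neg]
    exact mul_le_mul_of_nonneg_left
      (neg_le_neg (Real.log_le_log h0 (measureReal_preimage_le_comp g φ i))) h0.le

end Labels

/-- The word of length `n` that `g` reads along the orbit of a point. -/
def itinerary {X ι : Type*} (g : X → ι) (f : X → X) (n : ℕ) (x : X) : Fin n → ι :=
  fun k => g (f^[k] x)

/-- Gibbs' inequality compares the joint law of the two words with the model that keeps the law of
the `h`-word and draws each `g`-letter independently given the `h`-letter at the same time.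
Invariance makes each time contribute the same conditional entropy. -/
theorem labelEntropy_itinerary_le {X ι κ : Type*} [MeasurableSpace X] [Fintype ι] [Fintype κ]
    {μ : Measure X} [IsProbabilityMeasure μ] {f : X → X} (hf : MeasurePreserving f μ μ)
    {g : X → ι} {h : X → κ} (hg : ∀ i, MeasurableSet (g ⁻¹' {i}))
    (hh : ∀ j, MeasurableSet (h ⁻¹' {j})) (n : ℕ) :
    labelEntropy μ (itinerary g f n) ≤ labelEntropy μ (itinerary h f n) +
      n * matrixCondEntropy fun c : ι × κ => μ.real ((fun x => (g x, h x)) ⁻¹' {c}) := by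
  classical
  set p : ι × κ → ℝ := fun c => μ.real ((fun x => (g x, h x)) ⁻¹' {c}) with hp
  have hp0 : ∀ c, 0 ≤ p c := fun c => measureReal_nonneg
  set G : X → (Fin n → ι) × (Fin n → κ) := fun x => (itinerary g f n x, itinerary h f n x) with hG
  have hitg : ∀ a, MeasurableSet (itinerary g f n ⁻¹' {a}) := by
    intro a
    have : itinerary g f n ⁻¹' {a} = ⋂ k : Fin n, f^[k] ⁻¹' (g ⁻¹' {a k}) := by
      ext x; simp [itinerary, funext_iff]
    rw [this]
    exact MeasurableSet.iInter fun k => hf.measurable.iterate k (hg _)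
  have hith : ∀ a, MeasurableSet (itinerary h f n ⁻¹' {a}) := by
    intro a
    have : itinerary h f n ⁻¹' {a} = ⋂ k : Fin n, f^[k] ⁻¹' (h ⁻¹' {a k}) := by
      ext x; simp [itinerary, funext_iff]
    rw [this]
    exact MeasurableSet.iInter fun k => hf.measurable.iterate k (hh _)
  have hGm : ∀ c, MeasurableSet (G ⁻¹' {c}) := by
    intro c
    have : G ⁻¹' {c} = itinerary g f n ⁻¹' {c.1} ∩ itinerary h f n ⁻¹' {c.2} := by
      ext x; simp [hG, Prod.ext_iff]
    rw [this]
    exact (hitg _).inter (hith _)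
  have hpm : ∀ c, MeasurableSet ((fun x => (g x, h x)) ⁻¹' {c}) := by
    intro c
    have : (fun x => (g x, h x)) ⁻¹' {c} = g ⁻¹' {c.1} ∩ h ⁻¹' {c.2} := by
      ext x; simp [Prod.ext_iff]
    rw [this]
    exact (hg _).inter (hh _)
  set P : (Fin n → κ) → ℝ := fun b => μ.real (itinerary h f n ⁻¹' {b}) with hP
  have hP0 : ∀ c, 0 ≤ P c := fun c => measureReal_nonneg
  set C : ι × κ → ℝ := fun c => p c / ∑ i, p (i, c.2) with hC
  have hC0 : ∀ c, 0 ≤ C c := fun c => div_nonneg (hp0 _) (Finset.sum_nonneg fun i _ => hp0 _)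
  have hCpos : ∀ c, 0 < p c → 0 < C c := fun c hc =>
    div_pos hc (hc.trans_le (Finset.single_le_sum (f := fun i => p (i, c.2))
      (fun i _ => hp0 _) (Finset.mem_univ c.1)))
  have hmarg : ∀ (k : Fin n) c,
      μ.real ((fun x => ((G x).1 k, (G x).2 k)) ⁻¹' {c}) = p c := fun k c =>
    (hf.iterate k).measureReal_preimage (hpm c).nullMeasurableSet
  have hpk : ∀ c (k : Fin n), μ.real (G ⁻¹' {c}) ≤ p (c.1 k, c.2 k) := fun c k => by
    rw [← hmarg k]
    exact measureReal_preimage_le_comp G (fun c => (c.1 k, c.2 k)) c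
  have hPk : ∀ c, μ.real (G ⁻¹' {c}) ≤ P c.2 := fun c =>
    measureReal_preimage_le_comp G (fun c => c.2) c
  have htotG : ∑ c, μ.real (G ⁻¹' {c}) = 1 := by
    rw [sum_measureReal_preimage_singleton _ fun i _ => hGm i]
    simp
  have htotP : ∑ b, P b = 1 := by
    rw [hP, sum_measureReal_preimage_singleton _ fun i _ => hith i]
    simp
  -- The model has total mass at most 1. It may be less, since columns of weight zero have `C = 0`
  -- by the convention for division by zero.
  have hq : ∑ c : (Fin n → ι) × (Fin n → κ), P c.2 * ∏ k, C (c.1 k, c.2 k) ≤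
      ∑ c, μ.real (G ⁻¹' {c}) := by
    rw [htotG, Fintype.sum_prod_type_right, ← htotP]
    refine Finset.sum_le_sum fun b _ => ?_
    simp only [← Finset.mul_sum]
    refine mul_le_of_le_one_right (hP0 b) ?_
    have := Finset.prod_univ_sum (fun _ : Fin n => (Finset.univ : Finset ι))
      fun k i => C (i, b k)
    rw [Fintype.piFinset_univ] at this
    rw [← this]
    refine Finset.prod_le_one (fun k _ => Finset.sum_nonneg fun i _ => hC0 _) fun k _ => ?_
    simp only [hC, ← Finset.sum_div]
    exact div_self_le_one _
  have hgibbs := sum_negMulLog_le (fun c => measureReal_nonneg (μ := μ) (s := G ⁻¹' {c}))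
    (fun c => mul_nonneg (hP0 c.2) (Finset.prod_nonneg fun k _ => hC0 _))
    (fun c hc => mul_pos (hc.trans_le (hPk c))
      (Finset.prod_pos fun k _ => hCpos _ (hc.trans_le (hpk c k)))) hq
  have hsplit : ∀ c : (Fin n → ι) × (Fin n → κ),
      μ.real (G ⁻¹' {c}) * (-Real.log (P c.2 * ∏ k, C (c.1 k, c.2 k))) =
      μ.real (G ⁻¹' {c}) * (-Real.log (P c.2)) +
        ∑ k, μ.real (G ⁻¹' {c}) * (-Real.log (C (c.1 k, c.2 k))) := by
    intro c
    rcases (measureReal_nonneg (μ := μ) (s := G ⁻¹' {c})).eq_or_lt with h0 | h0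
    · simp [← h0]
    · have h1 : ∀ k, C (c.1 k, c.2 k) ≠ 0 := fun k => (hCpos _ (h0.trans_le (hpk c k))).ne'
      rw [Real.log_mul (h0.trans_le (hPk c)).ne' (Finset.prod_ne_zero_iff.mpr fun k _ => h1 k),
        Real.log_prod fun k _ => h1 k, ← Finset.mul_sum, Finset.sum_neg_distrib]
      ring
  rw [Finset.sum_congr rfl fun c _ => hsplit c, Finset.sum_add_distrib, Finset.sum_comm,
    sum_measureReal_preimage_mul hGm (fun c => c.2) fun b => -Real.log (P b)] at hgibbs
  have hterm : ∀ k : Fin n, ∑ c, μ.real (G ⁻¹' {c}) * (-Real.log (C (c.1 k, c.2 k))) =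
      matrixCondEntropy p := by
    intro k
    rw [sum_measureReal_preimage_mul hGm (fun c => (c.1 k, c.2 k)) fun b => -Real.log (C b),
      matrixCondEntropy_eq hp0]
    exact Finset.sum_congr rfl fun c _ => by rw [hmarg k]
  rw [Finset.sum_congr rfl fun k _ => hterm k] at hgibbs
  have hmono := labelEntropy_comp_le (μ := μ) hGm fun c => c.1
  have hPent : ∑ j, μ.real ((fun x => (G x).2) ⁻¹' {j}) * -Real.log (P j) =
      labelEntropy μ (itinerary h f n) := by
    simp [labelEntropy, Real.negMulLog, hP, hG]
  rw [hPent] at hgibbs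
  simp only [Finset.sum_const, Finset.card_univ, Fintype.card_fin, nsmul_eq_mul] at hgibbs
  exact hmono.trans hgibbs

/-! ### Generic levels and Borel–Cantelli -/

/-- For almost every threshold `r`, the weights of the layers of width `a n` around the level `r`
are summable. -/
theorem ae_tsum_measure_layer_ne_top {X : Type*} [MeasurableSpace X] (μ : Measure X)
    [IsFiniteMeasure μ] {g : X → ℝ} (hg : Measurable g) {a : ℕ → ℝ} (ha : ∀ n, 0 ≤ a n)
    (hsum : Summable a) :
    ∀ᵐ r : ℝ, ∑' n, μ {x | |g x - r| < a n} ≠ ⊤ := by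
  have hS : ∀ n, MeasurableSet {z : X × ℝ | |g z.1 - z.2| < a n} := fun n =>
    measurableSet_lt (by fun_prop) (by fun_prop)
  -- Fubini: for fixed x the admissible r form an interval of length `2 * a n`.
  have hint : ∀ n, ∫⁻ r : ℝ, μ {x | |g x - r| < a n} = ENNReal.ofReal (2 * a n) * μ univ := by
    intro n
    have h1 := Measure.prod_apply_symm (μ := μ) (ν := (volume : Measure ℝ)) (hS n)
    have h2 := Measure.prod_apply (μ := μ) (ν := (volume : Measure ℝ)) (hS n)
    have h3 : ∀ x, Prod.mk x ⁻¹' {z : X × ℝ | |g z.1 - z.2| < a n} = Metric.ball (g x) (a n) := by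
      intro x; ext r; simp [Real.dist_eq, abs_sub_comm]
    simp only [h3, Real.volume_ball, lintegral_const] at h2
    rw [← h2, h1]
    rfl
  have hmeas : ∀ n, Measurable fun r : ℝ => μ {x | |g x - r| < a n} := fun n =>
    measurable_measure_prodMk_right (hS n)
  have htot : ∫⁻ r : ℝ, ∑' n, μ {x | |g x - r| < a n} ≠ ⊤ := by
    rw [lintegral_tsum fun n => (hmeas n).aemeasurable]
    simp only [hint]
    rw [ENNReal.tsum_mul_right]
    refine ENNReal.mul_ne_top ?_ (measure_ne_top _ _)
    rw [← ENNReal.ofReal_tsum_of_nonneg (fun n => by have := ha n; positivity)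
      (hsum.mul_left 2)]
    exact ENNReal.ofReal_ne_top
  filter_upwards [ae_lt_top (Measurable.tsum hmeas) htot] with r hr using hr.ne

/-- Orbits approach a layered level slower than the widths of its layers. -/
theorem ae_eventually_le_abs_sub_iterate {X : Type*} [MeasurableSpace X] {μ : Measure X}
    {f : X → X} (hf : MeasurePreserving f μ μ) {g : X → ℝ} (hg : Measurable g) {a : ℕ → ℝ} {r : ℝ}
    (hr : ∑' n, μ {x | |g x - r| < a n} ≠ ⊤) :
    ∀ᵐ x ∂μ, ∀ᶠ n in atTop, a n ≤ |g (f^[n] x) - r| := by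
  have h : ∀ n, μ (f^[n] ⁻¹' {x | |g x - r| < a n}) = μ {x | |g x - r| < a n} := fun n =>
    (hf.iterate n).measure_preimage
      (measurableSet_lt (by fun_prop) (by fun_prop)).nullMeasurableSet
  filter_upwards [ae_eventually_notMem (μ := μ) (s := fun n => f^[n] ⁻¹' {x | |g x - r| < a n})
    (by simpa only [h] using hr)] with x hx
  filter_upwards [hx] with n hn
  simpa using hn

theorem measure_level_eq_zero {X : Type*} [MeasurableSpace X] {μ : Measure X} {g : X → ℝ}
    {a : ℕ → ℝ} (ha : ∀ n, 0 < a n) {r : ℝ} (hr : ∑' n, μ {x | |g x - r| < a n} ≠ ⊤) :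
    μ {x | g x = r} = 0 := by
  have := ae_eventually_notMem hr
  refine measure_mono_null (fun x hx => ?_) this
  have hx : g x = r := hx
  simpa [hx] using fun n : ℕ => ⟨n, le_rfl, ha n⟩

theorem ae_forall_continuousAt_iterate {X : Type*} [TopologicalSpace X] [MeasurableSpace X]
    {μ : Measure X} {f : X → X} (hf : MeasurePreserving f μ μ)
    (hcont : ∀ᵐ x ∂μ, ContinuousAt f x) : ∀ᵐ x ∂μ, ∀ n, ContinuousAt f^[n] x := by
  have h : ∀ᵐ x ∂μ, ∀ n, ContinuousAt f (f^[n] x) :=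
    ae_all_iff.mpr fun n => (hf.iterate n).quasiMeasurePreserving.ae hcont
  filter_upwards [h] with x hx n
  induction n with
  | zero => exact continuousAt_id
  | succ n ih =>
    rw [Function.iterate_succ']
    exact (hx n).comp ih

/-! ### Threshold labels and large interior -/

/-- The labels of a family of functions relative to a threshold. -/
noncomputable def thresholdLabel {X ι : Type*} (g : ι → X → ℝ) (r : ℝ) (x : X) : ι → Bool :=
  fun i => decide (r < g i x)

/-- Each `g i` varies by less than its gap to `r`, so it cannot cross `r`. -/
theorem thresholdLabel_eq_of_dist_lt {X ι : Type*} [PseudoMetricSpace X] {g : ι → X → ℝ}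
    {c : ℝ} (hg : ∀ i x y, |g i x - g i y| ≤ c * dist x y) {r : ℝ} {x y : X}
    (h : ∀ i, c * dist x y < |g i x - r|) : thresholdLabel g r y = thresholdLabel g r x := by
  funext i
  have h1 := hg i x y
  have h2 := (abs_le.mp (h1))
  refine decide_eq_decide.mpr ⟨fun h3 => ?_, fun h3 => ?_⟩
  · by_contra h4
    have := h i
    rw [abs_of_nonpos (by linarith)] at this
    linarith [h2.1]
  · have := h i
    rw [abs_of_nonneg (by linarith)] at this
    linarith [h2.2]

/-- Points that start exponentially close keep the same labels, along the orbit of a typical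
point. -/
theorem ae_exists_thresholdLabel_iterate_eq {X ι : Type*} [Finite ι] [MetricSpace X]
    [MeasurableSpace X] [BorelSpace X] {μ : Measure X} {f : X → X} (hf : MeasurePreserving f μ μ)
    (hcont : ∀ᵐ x ∂μ, ContinuousAt f x) (hsens : ReasonablySensitive f μ) {g : ι → X → ℝ}
    {c : ℝ} (hc : 0 < c) (hg : ∀ i x y, |g i x - g i y| ≤ c * dist x y) {r : ℝ}
    (hr : ∀ i, ∑' n : ℕ, μ {x | |g i x - r| < c * Real.exp (-n)} ≠ ⊤) :
    ∀ᵐ x ∂μ, ∃ χ : ℝ, ∀ᶠ n : ℕ in atTop, ∀ y ∈ Metric.ball x (Real.exp (-χ * n)), ∀ k < n,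
      thresholdLabel g r (f^[k] y) = thresholdLabel g r (f^[k] x) := by
  have hgc : ∀ i, Continuous (g i) := fun i =>
    (LipschitzWith.of_dist_le_mul (K := ⟨c, hc.le⟩) fun x y => by
      rw [Real.dist_eq]; exact hg i x y).continuous
  have hlevel : ∀ᵐ x ∂μ, ∀ i, g i x ≠ r := ae_all_iff.mpr fun i =>
    measure_level_eq_zero (fun n => by positivity) (hr i) |> fun h => by
      simpa [ae_iff] using h
  have hlevel' : ∀ᵐ x ∂μ, ∀ n : ℕ, ∀ i, g i (f^[n] x) ≠ r :=
    ae_all_iff.mpr fun n => (hf.iterate n).quasiMeasurePreserving.ae hlevel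
  have hfar : ∀ᵐ x ∂μ, ∀ i, ∀ᶠ n : ℕ in atTop, c * Real.exp (-n) ≤ |g i (f^[n] x) - r| :=
    ae_all_iff.mpr fun i => ae_eventually_le_abs_sub_iterate hf (hgc i).measurable (hr i)
  filter_upwards [hlevel', hfar, hsens, ae_forall_continuousAt_iterate hf hcont]
    with x hx1 hx2 hx3 hx4
  obtain ⟨γ, hγ, lam, hlam, hlip⟩ := hx3
  -- From time `N` on, both the Lipschitz bound and the distance to the levels are available; before
  -- `N`, continuity of the iterates off the levels suffices.
  obtain ⟨N, hN⟩ := eventually_atTop.mp (hlip.and (eventually_all.mpr hx2))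
  have hinit : ∀ᶠ y in 𝓝 x, ∀ k < N,
      thresholdLabel g r (f^[k] y) = thresholdLabel g r (f^[k] x) := by
    refine (eventually_all_finite (Set.finite_lt_nat N)).mpr fun k _ => ?_
    have h1 : ∀ i, ∀ᶠ y in 𝓝 x, decide (r < g i (f^[k] y)) = decide (r < g i (f^[k] x)) := by
      intro i
      have h2 : Tendsto (fun y => g i (f^[k] y)) (𝓝 x) (𝓝 (g i (f^[k] x))) :=
        ((hgc i).continuousAt.tendsto).comp (hx4 k)
      rcases lt_or_gt_of_ne (hx1 k i) with h3 | h3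
      · filter_upwards [h2.eventually_lt_const h3] with y hy
        simp [hy.not_gt, h3.not_gt]
      · filter_upwards [h2.eventually_const_lt h3] with y hy
        simp [hy, h3]
    filter_upwards [eventually_all.mpr h1] with y hy
    exact funext hy
  obtain ⟨δ, hδ, hball⟩ := Metric.eventually_nhds_iff_ball.mp hinit
  -- Here `γ` keeps `y` in the Lipschitz ball, `lam` offsets the expansion, and `1` leaves the
  -- factor `exp (-k)` that matches the layers.
  refine ⟨γ + lam + 1, ?_⟩
  have hlim : Tendsto (fun n : ℕ => Real.exp (-(γ + lam + 1) * n)) atTop (𝓝 0) := by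
    refine Real.tendsto_exp_atBot.comp ?_
    exact tendsto_natCast_atTop_atTop.const_mul_atTop_of_neg (by linarith)
  filter_upwards [hlim.eventually_lt_const hδ] with n hn y hy k hk
  by_cases hkN : k < N
  · exact hball y (Metric.ball_subset_ball hn.le hy) k hkN
  · obtain ⟨h1, h2⟩ := hN k (not_lt.mp hkN)
    have hkn : (k : ℝ) ≤ n := by exact_mod_cast hk.le
    rw [Metric.mem_ball, dist_comm] at hy
    have hyk : dist x y < Real.exp (-(γ + lam + 1) * k) := hy.trans_le (Real.exp_le_exp.mpr (by
      nlinarith))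
    have hyγ : y ∈ Metric.ball x (Real.exp (-γ * k)) := by
      rw [Metric.mem_ball, dist_comm]
      have : (0 : ℝ) ≤ k := k.cast_nonneg
      exact hyk.trans_le (Real.exp_le_exp.mpr (by nlinarith))
    have h3 := h1.dist_le_mul x (Metric.mem_ball_self (Real.exp_pos _)) y hyγ
    rw [Real.coe_toNNReal _ (Real.exp_pos _).le] at h3
    refine thresholdLabel_eq_of_dist_lt hg fun i => lt_of_lt_of_le ?_ (h2 i)
    gcongr
    calc _ ≤ _ := h3
      _ < Real.exp (lam * k) * Real.exp (-(γ + lam + 1) * k) := by gcongr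
      _ ≤ Real.exp (-k) := by
        rw [← Real.exp_add]
        have : (0 : ℝ) ≤ k := k.cast_nonneg
        exact Real.exp_le_exp.mpr (by nlinarith)

/-! ### Partitions given by labels -/

namespace MeasPartition

variable {ι X : Type*} [MeasurableSpace X]

/-- The partition into the level sets of a label function. -/
def ofLabel (g : X → ι) (hg : ∀ i, MeasurableSet (g ⁻¹' {i})) : MeasPartition ι X where
  cell i := g ⁻¹' {i}
  measurableSet_cell := hg
  disjoint_cell i j hij := by
    rw [Set.disjoint_left]
    rintro x rfl hx
    exact hij hx
  iUnion_cell := Set.eq_univ_of_forall fun x => Set.mem_iUnion.mpr ⟨g x, rfl⟩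

theorem exists_eq_ofLabel (ξ : MeasPartition ι X) :
    ∃ (g : X → ι) (hg : ∀ i, MeasurableSet (g ⁻¹' {i})), ξ = ofLabel g hg := by
  have h : ∀ x, ∃ i, x ∈ ξ.cell i := fun x =>
    Set.mem_iUnion.mp (ξ.iUnion_cell ▸ Set.mem_univ x)
  choose g hg using h
  have hcell : ∀ i, ξ.cell i = g ⁻¹' {i} := by
    intro i
    ext x
    constructor
    · intro hx
      by_contra h
      exact Set.disjoint_left.mp (ξ.disjoint_cell _ _ h) (hg x) hx
    · rintro rfl
      exact hg x
  refine ⟨g, fun i => hcell i ▸ ξ.measurableSet_cell i, ?_⟩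
  cases ξ
  simp only [ofLabel, mk.injEq]
  exact funext hcell

theorem dynamical_ofLabel_cell {g : X → ι} (hg : ∀ i, MeasurableSet (g ⁻¹' {i})) {f : X → X}
    (hf : Measurable f) (n : ℕ) (a : Fin n → ι) :
    ((ofLabel g hg).dynamical f hf n).cell a = itinerary g f n ⁻¹' {a} := by
  ext x
  simp [dynamical, ofLabel, itinerary, funext_iff]

theorem shannonEntropy_dynamical_ofLabel [Fintype ι] {μ : Measure X} {g : X → ι}
    (hg : ∀ i, MeasurableSet (g ⁻¹' {i})) {f : X → X} (hf : Measurable f) (n : ℕ) :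
    ((ofLabel g hg).dynamical f hf n).shannonEntropy μ = labelEntropy μ (itinerary g f n) := by
  simp only [shannonEntropy, dynamical_ofLabel_cell, labelEntropy]

theorem mem_dynamical_ofLabel_atom {g : X → ι} (hg : ∀ i, MeasurableSet (g ⁻¹' {i})) {f : X → X}
    (hf : Measurable f) {n : ℕ} {x y : X} (h : ∀ k < n, g (f^[k] y) = g (f^[k] x)) :
    y ∈ ((ofLabel g hg).dynamical f hf n).atom x := by
  refine ⟨itinerary g f n x, ?_, ?_⟩
  · rw [dynamical_ofLabel_cell]; rfl
  · rw [dynamical_ofLabel_cell]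
    exact funext fun k => h k k.2

/-- If the conditional entropy of `g` given `h` is smaller than the entropy of the partition
defined by `g`, then the partition defined by `h` has positive entropy. -/
theorem entropy_ofLabel_pos {κ : Type*} [Fintype ι] [Fintype κ] {μ : Measure X}
    [IsProbabilityMeasure μ] {f : X → X} (hf : MeasurePreserving f μ μ) {g : X → ι}
    (hg : ∀ i, MeasurableSet (g ⁻¹' {i})) {h : X → κ} (hh : ∀ i, MeasurableSet (h ⁻¹' {i}))
    (hlt : (matrixCondEntropy (fun c : ι × κ => μ.real ((fun x => (g x, h x)) ⁻¹' {c})) : EReal) <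
      (ofLabel g hg).entropy f hf.measurable μ) :
    0 < (ofLabel h hh).entropy f hf.measurable μ := by
  obtain ⟨s, hs1, hs2⟩ := EReal.lt_iff_exists_real_btwn.mp hlt
  set e := matrixCondEntropy (fun c : ι × κ => μ.real ((fun x => (g x, h x)) ⁻¹' {c}))
  have hs1 : e < s := by exact_mod_cast hs1
  -- Infinitely many n suffice, as the entropy is a limsup; n > 0 allows clearing the denominator.
  have hfreq := (frequently_lt_of_lt_limsup (by isBoundedDefault) hs2).and_eventually
    (eventually_gt_atTop 0)
  have : ((s - e : ℝ) : EReal) ≤ (ofLabel h hh).entropy f hf.measurable μ := by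
    refine le_limsup_of_frequently_le (hfreq.mono fun n hn => ?_) (by isBoundedDefault)
    obtain ⟨h1, h2⟩ := hn
    have h2 : (0 : ℝ) < n := by exact_mod_cast h2
    have h1 := EReal.coe_lt_coe_iff.mp h1
    rw [shannonEntropy_dynamical_ofLabel, lt_div_iff₀ h2] at h1
    refine EReal.coe_le_coe_iff.mpr ?_
    rw [shannonEntropy_dynamical_ofLabel, le_div_iff₀ h2]
    have := labelEntropy_itinerary_le hf hg hh n
    linarith
  refine lt_of_lt_of_le ?_ this
  exact_mod_cast sub_pos.mpr hs1

end MeasPartition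

/-! ### Lipschitz approximation and conclusion -/

/-- A label function is approximated in measure by the label functions `thresholdLabel φ r`
of Lipschitz functions `φ i`. -/
theorem exists_lipschitz_thresholdLabel_approx {X ι : Type*} [Finite ι] [MetricSpace X]
    [MeasurableSpace X] [BorelSpace X] {μ : Measure X} [IsFiniteMeasure μ]
    [μ.InnerRegularCompactLTTop] [DecidableEq ι] {g : X → ι}
    (hg : ∀ i, MeasurableSet (g ⁻¹' {i})) {ε : ℝ} (hε : 0 < ε) :
    ∃ (φ : ι → X → ℝ) (c : ℝ), 0 < c ∧ (∀ i x y, |φ i x - φ i y| ≤ c * dist x y) ∧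
      ∀ r ∈ Ioo (0 : ℝ) 1, ∀ i,
        μ.real {x | g x = i ∧ thresholdLabel φ r x ≠ fun j => decide (j = i)} < ε := by
  have hK : ∀ i, ∃ K ⊆ g ⁻¹' {i}, IsCompact K ∧ μ (g ⁻¹' {i} \ K) < ENNReal.ofReal ε := fun i =>
    (hg i).exists_isCompact_sdiff_lt (measure_ne_top _ _) (by simpa using hε)
  choose K hKg hKc hKμ using hK
  -- The thickened indicator of `K i` is then 1 on `K i` and 0 on the other `K j`, so every
  -- threshold in (0, 1) labels the compact sets correctly.
  have hδ : ∀ i, ∃ δ, 0 < δ ∧ ∀ j ≠ i, Disjoint (Metric.thickening δ (K i)) (K j) := by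
    intro i
    have hd : Disjoint (K i) (⋃ j ∈ {j | j ≠ i}, K j) := by
      refine Set.disjoint_iUnion₂_right.mpr fun j hj => ?_
      refine Set.disjoint_left.mpr fun x hx hx' => hj ?_
      rw [← show g x = j from hKg j hx', show g x = i from hKg i hx]
    obtain ⟨δ, hδ, h⟩ := hd.exists_thickenings (hKc i)
      ((Set.toFinite {j | j ≠ i}).isCompact_biUnion fun j _ => hKc j).isClosed
    exact ⟨δ, hδ, fun j hj => h.mono_right ((Set.subset_biUnion_of_mem (u := K) hj).trans
      (Metric.self_subset_thickening hδ _))⟩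
  choose δ hδ hdisj using hδ
  have hφ : ∀ i, LipschitzWith (δ i).toNNReal⁻¹
      fun x => ((thickenedIndicator (hδ i) (K i) x : NNReal) : ℝ) := fun i =>
    lipschitzWith_thickenedIndicator (hδ i) (K i)
  have := Fintype.ofFinite ι
  refine ⟨fun i x => ((thickenedIndicator (hδ i) (K i) x : NNReal) : ℝ),
    (∑ i, ((δ i).toNNReal⁻¹ : NNReal)) + 1, by positivity, fun i x y => ?_, fun r hr i => ?_⟩
  · rw [← Real.dist_eq]
    refine ((hφ i).dist_le_mul x y).trans ?_
    gcongr
    have : (δ i).toNNReal⁻¹ ≤ ∑ i, (δ i).toNNReal⁻¹ :=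
      Finset.single_le_sum (f := fun i => (δ i).toNNReal⁻¹) (fun i _ => zero_le) (Finset.mem_univ i)
    have : (((δ i).toNNReal⁻¹ : NNReal) : ℝ) ≤ ((∑ i, (δ i).toNNReal⁻¹ : NNReal) : ℝ) := by
      exact_mod_cast this
    push_cast at this ⊢
    linarith
  · have hsub : {x | g x = i ∧ thresholdLabel
        (fun i x => ((thickenedIndicator (hδ i) (K i) x : NNReal) : ℝ)) r x ≠
          fun j => decide (j = i)} ⊆ g ⁻¹' {i} \ K i := by
      rintro x ⟨hx1, hx2⟩
      refine ⟨hx1, fun hx => hx2 (funext fun j => decide_eq_decide.mpr ?_)⟩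
      by_cases hj : j = i
      · subst hj
        simp only [thickenedIndicator_one (hδ j) (K j) hx, iff_true]
        simpa using hr.2
      · have h0 : x ∉ Metric.thickening (δ j) (K j) := fun h =>
          Set.disjoint_left.mp (hdisj j i (Ne.symm hj)) h hx
        simp only [thickenedIndicator_zero (hδ j) (K j) h0, hj, iff_false]
        simpa using hr.1.le
    refine (measureReal_mono hsub).trans_lt ?_
    exact (ENNReal.lt_ofReal_iff_toReal_lt (measure_ne_top _ _)).mp (hKμ i)

theorem mainTheorem6 {X : Type*} [NormedAddCommGroup X] [InnerProductSpace ℝ X]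
    [FiniteDimensional ℝ X] [MeasurableSpace X] [BorelSpace X]
    (μ : Measure X) [IsProbabilityMeasure μ] (f : X → X) (hf : MeasurePreserving f μ μ)
    (hcont : ∀ᵐ x ∂μ, ContinuousAt f x)
    (hsens : ReasonablySensitive f μ)
    (hent : 0 < metricEntropy f hf.measurable μ) :
    ∃ (k : ℕ) (ξ : MeasPartition (Fin k) X),
      ξ.HasLargeInterior f hf.measurable μ ∧ 0 < ξ.entropy f hf.measurable μ := by
  obtain ⟨k, hk⟩ := lt_iSup_iff.mp hent
  obtain ⟨η, hη⟩ := lt_iSup_iff.mp hk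
  obtain ⟨g, hg, rfl⟩ := η.exists_eq_ofLabel
  obtain ⟨s, hs0, hs⟩ := EReal.lt_iff_exists_real_btwn.mp hη
  have hs0 : 0 < s := by exact_mod_cast hs0
  -- The number of labels is fixed before the approximation, so the continuity modulus `δ` below
  -- does not depend on `φ` or `r`; `e i` encodes the word that marks only `i`.
  let E := Fintype.equivFin (Fin k → Bool)
  let e : Fin k → Fin (Fintype.card (Fin k → Bool)) := fun i => E fun j => decide (j = i)
  have he : Function.Injective e := by
    intro i j hij
    have := congrFun (E.injective hij) i
    simpa using this
  have hproper : ProperSpace X := FiniteDimensional.proper ℝ X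
  -- The centre is the joint matrix of a perfect approximation, with conditional entropy 0 < `s`.
  obtain ⟨δ, hδ, hball⟩ := Metric.isOpen_iff.mp
    (isOpen_lt (continuous_matrixCondEntropy (ι := Fin k)
      (κ := Fin (Fintype.card (Fin k → Bool)))) (continuous_const (y := s)))
    (fun c => if c.2 = e c.1 then μ.real (g ⁻¹' {c.1}) else 0)
    (by
      rw [Set.mem_ofPred_eq, matrixCondEntropy_graph (w := fun i => μ.real (g ⁻¹' {i}))
        (fun i => measureReal_nonneg) he]
      exact hs0)
  obtain ⟨φ, c, hc, hφ, happrox⟩ := exists_lipschitz_thresholdLabel_approx (μ := μ) hg hδ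
  have hφm : ∀ i, Measurable (φ i) := fun i =>
    (LipschitzWith.of_dist_le_mul (K := ⟨c, hc.le⟩) fun x y => by
      rw [Real.dist_eq]; exact hφ i x y).continuous.measurable
  have hthr : ∀ᵐ r : ℝ, ∀ i, ∑' n : ℕ, μ {x | |φ i x - r| < c * Real.exp (-n)} ≠ ⊤ :=
    ae_all_iff.mpr fun i => ae_tsum_measure_layer_ne_top μ (hφm i) (fun n => by positivity)
      (Real.summable_exp_neg_nat.mul_left c)
  obtain ⟨r, hr01, hr⟩ : ∃ r ∈ Ioo (0 : ℝ) 1,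
      ∀ i, ∑' n : ℕ, μ {x | |φ i x - r| < c * Real.exp (-n)} ≠ ⊤ := by
    by_contra! hcon
    have h0 : volume (Ioo (0 : ℝ) 1) = 0 := measure_mono_null (fun r hr => by
      simpa using hcon r hr) (ae_iff.mp hthr)
    simp at h0
  have hlabel : ∀ a, MeasurableSet ((fun x => E (thresholdLabel φ r x)) ⁻¹' {a}) := by
    intro a
    have : (fun x => E (thresholdLabel φ r x)) ⁻¹' {a} =
        ⋂ i, {x | r < φ i x ↔ E.symm a i = true} := by
      ext x
      simp only [mem_preimage, mem_singleton_iff, mem_iInter, mem_ofPred_eq,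
        ← Equiv.eq_symm_apply, funext_iff, thresholdLabel]
      exact forall_congr' fun i => by cases E.symm a i <;> simp
    rw [this]
    exact MeasurableSet.iInter fun i =>
      (measurableSet_lt measurable_const (hφm i)).iff (MeasurableSet.const _)
  refine ⟨_, MeasPartition.ofLabel _ hlabel, ?_, MeasPartition.entropy_ofLabel_pos hf hg hlabel
    (lt_trans (EReal.coe_lt_coe_iff.mpr (hball ?_)) hs)⟩
  · filter_upwards [ae_exists_thresholdLabel_iterate_eq hf hcont hsens hc hφ hr] with x hx
    obtain ⟨χ, hχ⟩ := hx
    refine ⟨χ, hχ.mono fun n hn y hy => ?_⟩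
    exact MeasPartition.mem_dynamical_ofLabel_atom hlabel hf.measurable fun k hk =>
      congrArg E (hn y hy k hk)
  -- In row `i`, the deficit on the graph and each entry off it are at most the measure of the
  -- mislabelled part of cell `i`.
  · rw [Metric.mem_ball, dist_pi_lt_iff hδ]
    rintro ⟨i, a⟩
    have hbad := happrox r hr01 i
    rw [Real.dist_eq]
    by_cases ha : a = e i
    · simp only [ha, if_true]
      have hsub : (fun x => (g x, E (thresholdLabel φ r x))) ⁻¹' {(i, e i)} ⊆ g ⁻¹' {i} :=
        fun x hx => (Prod.ext_iff.mp hx).1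
      have h1 : μ.real (g ⁻¹' {i}) ≤
          μ.real ((fun x => (g x, E (thresholdLabel φ r x))) ⁻¹' {(i, e i)}) +
          μ.real {x | g x = i ∧ thresholdLabel φ r x ≠ fun j => decide (j = i)} := by
        refine (measureReal_mono fun x hx => ?_).trans (measureReal_union_le _ _)
        by_cases h : thresholdLabel φ r x = fun j => decide (j = i)
        · exact Or.inl (Prod.ext hx (congrArg E h))
        · exact Or.inr ⟨hx, h⟩
      have h2 := measureReal_mono (μ := μ) hsub
      rw [abs_of_nonpos (by linarith)]
      linarith
    · simp only [ha, if_false, sub_zero]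
      rw [abs_of_nonneg measureReal_nonneg]
      refine (measureReal_mono fun x hx => ?_).trans_lt hbad
      have hx' := Prod.ext_iff.mp hx
      exact ⟨hx'.1, fun h => ha (hx'.2.symm.trans (congrArg E h))⟩
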